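/- Write $\mathbb{R}_{\max}=\mathbb{R}\cup\{-\infty\}$, with $-\infty+a=a+(-\infty)=-\infty$ for all $a\in\mathbb{R}_{\max}$. For a finite set $S\subset\mathbb{R}_{\max}^d$, its max-plus convex hull $\operatorname{mpconv}(S)$ is the set of all $x\in\mathbb{R}_{\max}^d$ of the form $x=\max_{y\in S}(\lambda_y+y)$ (componentwise maximum, $\lambda_y$ being added to each component of $y$) with coefficients $\lambda_y\in\mathbb{R}_{\max}$ such that $\max_{y\in S}\lambda_y=0$; in particular $\operatorname{mpconv}(\emptyset)=\emptyset$. **Theorem (max-plus Tverberg theorem).** Let $d\ge 0$ and $q\ge 1$ be integers and let $X$ be a set of $(d+1)(q-1)+1$ points in $\mathbb{R}_{\max}^d$. Then $X$ is the union of $q$ pairwise disjoint subsets $X_1,\dots,X_q$ whose max-plus convex hulls have a common point, i.e. $\bigcap_{i=1}^q\operatorname{mpconv}(X_i)\neq\emptyset$. -/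

import Mathlib

/-- The max-plus semiring carrier `ℝ ∪ {-∞}`; `⊥` is `-∞`, with `⊥ + a = a + ⊥ = ⊥`. -/
abbrev RMax : Type := WithBot ℝ

/-- The max-plus convex hull of a finite set `S` of points of `RMax ^ d`: the points
`x = max_{y ∈ S} (c y + y)`, taken componentwise, with coefficients `c y ∈ RMax` such that
`max_{y ∈ S} c y = 0`. A maximum over the empty set is `-∞`, so the hull of `∅` is empty. -/
def mpconv {d : ℕ} (S : Finset (Fin d → RMax)) : Set (Fin d → RMax) :=
  {x | ∃ c : (Fin d → RMax) → RMax,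
    S.sup c = 0 ∧ ∀ k : Fin d, x k = S.sup (fun y => c y + y k)}

open scoped Finset

/-! Adjoin a coordinate equal to 0, giving d + 1 labels, and put r = q - 1. Optimal transport
potentials (`exists_tight_potentials`) give `c y + N y k ≤ x k`, tight for at least q points per
label. It remains to q-colour the points so that each label has tight points of every colour: then
every class has the same maxima `x`. A generic infinitesimal perturbation makes the tight incidences
a forest (`exists_card_inter_biUnion_le_one`), which is coloured leaf by leaf
(`exists_coloring_of_acyclic`). Lexicographic triples carry both -∞ and the infinitesimal. -/

/-- Potentials of an optimal transport problem: every label `k` is tight at `r + 1` points or more. -/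
theorem exists_tight_potentials {X K Γ : Type*} [Fintype X] [Fintype K] [DecidableEq K]
    [Nonempty K] [AddCommGroup Γ] [LinearOrder Γ] [IsOrderedAddMonoid Γ]
    (r : ℕ) (M : X → K → Γ) (hcard : Fintype.card X = Fintype.card K * r + 1) :
    ∃ (x : K → Γ) (c : X → Γ), (∀ y k, c y + M y k ≤ x k) ∧
      ∀ k, r + 1 ≤ #{y | c y + M y k = x k} := by
  classical
  -- Every label is used `r` times, and `k` takes the one surplus point; `x k` below is the optimal
  -- value.
  let F : K → Finset (X → K) := fun k =>
    {f | ∀ j, #{y | f y = j} = r + if j = k then 1 else 0}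
  have hmem : ∀ {k f}, f ∈ F k ↔ ∀ j, #{y | f y = j} = r + if j = k then 1 else 0 := by
    simp [F]
  have hF : ∀ k, (F k).Nonempty := by
    intro k
    have hc : Fintype.card X =
        Fintype.card ((j : K) × Fin (r + if j = k then 1 else 0)) := by
      simp [hcard, Finset.sum_add_distrib]
    refine ⟨fun y => (Fintype.equivOfCardEq hc y).1, hmem.2 fun j => ?_⟩
    rw [← Fintype.card_fin (r + if j = k then 1 else 0), ← Fintype.card_subtype]
    exact Fintype.card_congr (((Fintype.equivOfCardEq hc).subtypeEquiv fun _ => Iff.rfl).trans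
      (Equiv.sigmaSubtype j))
  choose f hfF hfmax using fun k => (F k).exists_max_image (fun f => ∑ y, M y (f y)) (hF k)
  let x : K → Γ := fun k => ∑ y, M y (f k y)
  refine ⟨x, fun y => Finset.univ.inf' Finset.univ_nonempty fun k => x k - M y k, ?_, ?_⟩
  · intro y k
    rw [← le_sub_iff_add_le]
    exact Finset.inf'_le _ (Finset.mem_univ k)
  · intro k
    have h1 := hmem.1 (hfF k) k
    rw [if_pos rfl] at h1
    rw [← h1]
    refine Finset.card_le_card fun y hy => ?_
    have hy : f k y = k := by simpa using hy
    rw [Finset.mem_filter]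
    refine ⟨Finset.mem_univ y, ?_⟩
    rw [← eq_sub_iff_add_eq]
    refine le_antisymm (Finset.inf'_le _ (Finset.mem_univ k)) (Finset.le_inf' _ _ fun j _ => ?_)
    -- Moving `y` from `k` to `j` moves the surplus to `j`, so optimality of `x j` bounds the
    -- exchange.
    have hu : Function.update (f k) y j ∈ F j := by
      rw [hmem]
      intro i
      have h2 := hmem.1 (hfF k) i
      rcases eq_or_ne j k with rfl | hjk
      · rwa [show Function.update (f j) y j = f j by rw [Function.update_eq_self_iff, hy]]
      by_cases hij : i = j
      · subst hij
        have : ({z | Function.update (f k) y i z = i} : Finset X)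
            = insert y ({z | f k z = i} : Finset X) := by
          ext z; by_cases hz : z = y <;> simp [hz, Function.update_apply]
        rw [this, Finset.card_insert_of_notMem (by simp [hy, hjk.symm]), h2]
        simp [hjk]
      · have : ({z | Function.update (f k) y j z = i} : Finset X)
            = ({z | f k z = i} : Finset X).erase y := by
          ext z; by_cases hz : z = y <;> simp [hz, Function.update_apply, Ne.symm hij]
        rw [this]
        by_cases hik : i = k
        · subst hik
          rw [Finset.card_erase_of_mem (by simp [hy]), h2]
          simp [hij]
        · rw [Finset.erase_eq_of_notMem (by simp [hy, Ne.symm hik]), h2]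
          simp [hij, hik]
    have h3 := hfmax j _ hu
    have h4 : ∀ g : X → K, ∑ z, M z (g z) = M y (g y) + ∑ z ∈ Finset.univ.erase y, M z (g z) :=
      fun g => (Finset.add_sum_erase _ (fun z => M z (g z)) (Finset.mem_univ y)).symm
    have h5 : ∑ z ∈ Finset.univ.erase y, M z (Function.update (f k) y j z)
        = ∑ z ∈ Finset.univ.erase y, M z (f k z) :=
      Finset.sum_congr rfl fun z hz => by
        rw [Function.update_of_ne (Finset.ne_of_mem_erase hz)]
    simp only [x]
    rw [h4 (Function.update (f k) y j), h5, Function.update_self] at h3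
    rw [h4 (f k), hy, add_sub_cancel_left]
    exact le_sub_iff_add_le'.2 h3

/-- If the values `ε (y, k) = u k - v y` over the incidences `y ∈ A k` are rationally independent,
the incidence graph has no cycle, so some label shares at most one point with the others. -/
theorem exists_card_inter_biUnion_le_one {X K : Type*} [Fintype X] [DecidableEq X]
    [DecidableEq K] (ε : X × K → ℝ) (hε : LinearIndependent ℚ ε) (u : K → ℝ) (v : X → ℝ)
    (A : K → Finset X) (hA : ∀ k, ∀ y ∈ A k, ε (y, k) = u k - v y)
    (T : Finset K) (hT : T.Nonempty) :
    ∃ k ∈ T, #(A k ∩ (T.erase k).biUnion A) ≤ 1 := by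
  by_contra! hcon
  obtain ⟨k₀, hk₀⟩ := hT
  -- Double counting the incidences `E` with shared points gives `#E ≥ #T + #Y`.
  let Y : Finset X := {y | 2 ≤ #{k ∈ T | y ∈ A k}}
  let E : Finset (X × K) := {p ∈ Y ×ˢ T | p.1 ∈ A p.2}
  have hEY : #Y * 2 ≤ #E := by
    rw [Finset.card_eq_sum_card_fiberwise (f := Prod.fst) (t := Y)
      (fun p hp => by simp [E] at hp ⊢; exact hp.1.1)]
    rw [← smul_eq_mul]
    refine Finset.card_nsmul_le_sum _ _ _ fun y hy => ?_
    refine (Finset.mem_filter.1 hy).2.trans ?_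
    refine Finset.card_le_card_of_injOn (fun k => (y, k)) (fun k hk => ?_)
      fun _ _ _ _ h => by simpa using h
    simp at hk
    simp [E, hy, hk]
  have hET : #T * 2 ≤ #E := by
    rw [Finset.card_eq_sum_card_fiberwise (f := Prod.snd) (t := T)
      (fun p hp => by simp [E] at hp ⊢; exact hp.1.2)]
    rw [← smul_eq_mul]
    refine Finset.card_nsmul_le_sum _ _ _ fun k hk => ?_
    refine (hcon k hk).nat_succ_le.trans ?_
    refine Finset.card_le_card_of_injOn (fun y => (y, k)) (fun y hy => ?_)
      fun _ _ _ _ h => by simpa using h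
    simp only [Finset.coe_inter, Set.mem_inter_iff, Finset.mem_coe, Finset.mem_biUnion,
      Finset.mem_erase] at hy
    obtain ⟨hyk, j, ⟨hjk, hj⟩, hyj⟩ := hy
    have : y ∈ Y := by
      simp only [Y, Finset.mem_filter, Finset.mem_univ, true_and]
      exact Finset.one_lt_card.2 ⟨j, by simp [hj, hyj], k, by simp [hk, hyk], hjk⟩
    simp [E, this, hk, hyk]
  -- Only differences of potentials occur, so basing them at `k₀` saves one generator: `#T - 1 + #Y`
  -- suffice.
  let W : Finset ℝ := (T.erase k₀).image (fun k => u k - u k₀) ∪ Y.image fun y => u k₀ - v y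
  have hW : #W < #E := by
    have h1 : #W ≤ #(T.erase k₀) + #Y := (Finset.card_union_le _ _).trans
      (add_le_add Finset.card_image_le Finset.card_image_le)
    have h2 := Finset.card_erase_lt_of_mem hk₀
    omega
  have hspan : Set.range (fun p : E => ε p) ≤ Submodule.span ℚ (W : Set ℝ) := by
    rintro _ ⟨⟨⟨y, k⟩, hp⟩, rfl⟩
    simp only [E, Finset.mem_filter, Finset.mem_product] at hp
    obtain ⟨⟨hy, hk⟩, hyk⟩ := hp
    have h1 : u k₀ - v y ∈ Submodule.span ℚ (W : Set ℝ) :=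
      Submodule.subset_span (Finset.mem_union_right _ (Finset.mem_image_of_mem _ hy))
    have h2 : u k - u k₀ ∈ Submodule.span ℚ (W : Set ℝ) := by
      rcases eq_or_ne k k₀ with rfl | hne
      · simp
      · exact Submodule.subset_span (Finset.mem_union_left _
          (Finset.mem_image_of_mem (fun k => u k - u k₀) (Finset.mem_erase.2 ⟨hne, hk⟩)))
    have h3 := add_mem h2 h1
    simp only [SetLike.mem_coe]
    rw [hA k y hyk]
    simpa using h3
  have := linearIndependent_le_span_aux' _ (hε.comp (Subtype.val : E → X × K)
    Subtype.val_injective) (W : Set ℝ) hspan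
  simp only [Fintype.card_coe, Finset.coe_sort_coe] at this
  omega

/-- A family of finite sets with acyclic incidences, each of size `r + 1` or more, has an
`r + 1`-colouring of the points for which every set of the family meets every colour. -/
theorem exists_coloring_of_acyclic {X K : Type*} [DecidableEq X] [DecidableEq K] (r : ℕ)
    (A : K → Finset X) (hcard : ∀ k, r + 1 ≤ #(A k)) (S : Finset K)
    (hA : ∀ T ⊆ S, T.Nonempty → ∃ k ∈ T, #(A k ∩ (T.erase k).biUnion A) ≤ 1) :
    ∃ c : X → Fin (r + 1), ∀ k ∈ S, ∀ i, ∃ y ∈ A k, c y = i := by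
  induction hn : #S generalizing S with
  | zero => exact ⟨fun _ => 0, by simp [Finset.card_eq_zero.1 hn]⟩
  | succ n ih =>
    obtain ⟨k, hk, hle⟩ := hA S subset_rfl (Finset.card_pos.1 (by omega))
    obtain ⟨c, hc⟩ := ih (S.erase k)
      (fun T hT => hA T (hT.trans (Finset.erase_subset _ _)))
      (by rw [Finset.card_erase_of_mem hk, hn]; rfl)
    obtain ⟨g, hg⟩ : ∃ g : X → Fin (r + 1), ∀ i, ∃ y ∈ A k, g y = i := by
      obtain ⟨e⟩ : Nonempty (Fin (r + 1) ↪ A k) :=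
        Function.Embedding.nonempty_of_card_le (by simpa using hcard k)
      refine ⟨Function.invFun fun i => (e i : X), fun i => ⟨e i, (e i).2, ?_⟩⟩
      exact Function.leftInverse_invFun (Subtype.val_injective.comp e.injective) i
    obtain ⟨g', hg', hgc⟩ : ∃ g' : X → Fin (r + 1), (∀ i, ∃ y ∈ A k, g' y = i) ∧
        ∀ y ∈ A k ∩ (S.erase k).biUnion A, g' y = c y := by
      rcases (A k ∩ (S.erase k).biUnion A).eq_empty_or_nonempty with h | ⟨b, hb⟩
      · exact ⟨g, hg, by simp [h]⟩
      -- Permuting colours makes the new set agree with the old colouring at its only shared point.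
      · refine ⟨fun y => Equiv.swap (g b) (c b) (g y), fun i => ?_, fun y hy => ?_⟩
        · obtain ⟨y, hy, hyi⟩ := hg (Equiv.swap (g b) (c b) i)
          exact ⟨y, hy, by simp [hyi]⟩
        · rw [Finset.card_le_one.1 hle y hy b hb]
          exact Equiv.swap_apply_left _ _
    refine ⟨fun y => if y ∈ (S.erase k).biUnion A then c y else g' y, fun j hj i => ?_⟩
    by_cases hjk : j = k
    · subst hjk
      obtain ⟨y, hy, hyi⟩ := hg' i
      refine ⟨y, hy, ?_⟩
      by_cases hU : y ∈ (S.erase j).biUnion A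
      · simp only [if_pos hU]
        rw [← hgc y (Finset.mem_inter.2 ⟨hy, hU⟩), hyi]
      · simp only [if_neg hU, hyi]
    · have hj' : j ∈ S.erase k := Finset.mem_erase.2 ⟨hjk, hj⟩
      obtain ⟨y, hy, hyi⟩ := hc j hj' i
      exact ⟨y, hy, by simp only [if_pos (Finset.mem_biUnion.2 ⟨j, hj', hy⟩), hyi]⟩

theorem exists_linearIndependent_rat_real (ι : Type*) [Finite ι] :
    ∃ ε : ι → ℝ, LinearIndependent ℚ ε := by
  obtain ⟨n, ⟨e⟩⟩ := Finite.exists_equiv_fin ι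
  obtain ⟨v, hv⟩ := exists_linearIndependent_of_le_rank (R := ℚ) (M := ℝ) (n := n)
    (by rw [Real.rank_rat_real]; exact (Cardinal.nat_lt_continuum n).le)
  exact ⟨v ∘ e, hv.comp e e.injective⟩

/-- Real numbers with a leading coordinate for infinite parts and a trailing infinitesimal. -/
abbrev ExtReal : Type := ℝ ×ₗ (ℝ ×ₗ ℝ)

/-- The lift of `a : RMax` with infinitesimal part `e`; the infinite part of `-∞` is `-1`. -/
def RMax.lift : RMax → ℝ → ExtReal
  | ⊥, e => toLex (-1, toLex (0, e))
  | (a : ℝ), e => toLex (0, toLex (a, e))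

/-- The finite part, for elements whose infinite part is not positive. -/
noncomputable def ExtReal.toRMax (z : ExtReal) : RMax :=
  if (ofLex z).1 < 0 then ⊥ else ((ofLex (ofLex z).2).1 : ℝ)

theorem RMax.lift_fst_nonpos (a : RMax) (e : ℝ) : (ofLex (a.lift e)).1 ≤ 0 := by
  cases a <;> simp [RMax.lift]

theorem RMax.lift_snd_snd (a : RMax) (e : ℝ) : (ofLex (ofLex (a.lift e)).2).2 = e := by
  cases a <;> simp [RMax.lift]

theorem ExtReal.fst_mono {z w : ExtReal} (h : z ≤ w) : (ofLex z).1 ≤ (ofLex w).1 := by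
  rcases Prod.Lex.le_iff.1 h with h | h
  · exact h.le
  · exact h.1.le

theorem ExtReal.toRMax_mono {z w : ExtReal} (h : z ≤ w) (hw : (ofLex w).1 ≤ 0) :
    z.toRMax ≤ w.toRMax := by
  unfold ExtReal.toRMax
  rcases Prod.Lex.le_iff.1 h with h | ⟨h, h'⟩
  · rw [if_pos (h.trans_le hw)]
    exact bot_le
  · rw [h]
    split_ifs
    · exact le_rfl
    · rw [WithBot.coe_le_coe]
      rcases Prod.Lex.le_iff.1 h' with h' | h'
      · exact h'.le
      · exact h'.1.le

/-- The bound on `z` is essential: a positive infinite part could cancel the -1 that encodes -∞. -/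
theorem ExtReal.toRMax_add_lift {z : ExtReal} (hz : (ofLex z).1 ≤ 0) (a : RMax) (e : ℝ) :
    (z + a.lift e).toRMax = z.toRMax + a := by
  unfold ExtReal.toRMax
  induction a using WithBot.recBotCoe with
  | bot =>
    have : (ofLex z).1 + -1 < 0 := by linarith
    simp [RMax.lift, this]
  | coe a =>
    simp only [RMax.lift, ofLex_add, ofLex_toLex, Prod.fst_add, Prod.snd_add, add_zero]
    split_ifs <;> simp

/-- Homogeneous form: the colour classes of a suitable colouring attain the same maxima. -/
theorem exists_coloring_attaining {X K : Type*} [Fintype X] [Fintype K] (r : ℕ)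
    (N : X → K → RMax) (k₀ : K) (hk₀ : ∀ y, N y k₀ = 0)
    (hcard : Fintype.card X = Fintype.card K * r + 1) :
    ∃ (x : K → RMax) (c : X → RMax) (col : X → Fin (r + 1)), x k₀ = 0 ∧
      (∀ y k, c y + N y k ≤ x k) ∧ ∀ k i, ∃ y, col y = i ∧ c y + N y k = x k := by
  classical
  have : Nonempty K := ⟨k₀⟩
  obtain ⟨ε, hε⟩ := exists_linearIndependent_rat_real (X × K)
  obtain ⟨x, c, hle, htight⟩ :=
    exists_tight_potentials r (fun y k => (N y k).lift (ε (y, k))) hcard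
  let A : K → Finset X := fun k => {y | c y + (N y k).lift (ε (y, k)) = x k}
  have hA : ∀ {k y}, y ∈ A k → c y + (N y k).lift (ε (y, k)) = x k := fun h => by
    simpa [A] using h
  obtain ⟨col, hcol⟩ := exists_coloring_of_acyclic r A htight Finset.univ fun T _ hT =>
    exists_card_inter_biUnion_le_one ε hε (fun k => (ofLex (ofLex (x k)).2).2)
      (fun y => (ofLex (ofLex (c y)).2).2) A (fun k y hy => by
        have h := congrArg (fun z : ExtReal => (ofLex (ofLex z).2).2) (hA hy)
        simp only [ofLex_add, Prod.snd_add, RMax.lift_snd_snd] at h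
        linarith) T hT
  have hcol' : ∀ k i, ∃ y, col y = i ∧ c y + (N y k).lift (ε (y, k)) = x k := fun k i => by
    obtain ⟨y, hy, h⟩ := hcol k (Finset.mem_univ k) i
    exact ⟨y, h, hA hy⟩
  -- The zero column `k₀` bounds all infinite parts after normalising by `x k₀`; tight points pass
  -- the bound on to each `x k`.
  have hc : ∀ y, (ofLex (c y - x k₀)).1 ≤ 0 := fun y => by
    have h := ExtReal.fst_mono (hle y k₀)
    have h0 : (ofLex ((N y k₀).lift (ε (y, k₀)))).1 = 0 := by rw [hk₀]; rfl
    simp only [ofLex_add, Prod.fst_add, h0, ofLex_sub, Prod.fst_sub] at h ⊢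
    linarith
  have heq : ∀ y k, (c y - x k₀).toRMax + N y k
      = (c y + (N y k).lift (ε (y, k)) - x k₀).toRMax := fun y k => by
    rw [← ExtReal.toRMax_add_lift (hc y), sub_add_eq_add_sub]
  have hx : ∀ k, (ofLex (x k - x k₀)).1 ≤ 0 := fun k => by
    obtain ⟨y, -, h⟩ := hcol' k 0
    have h1 := hc y
    have h2 := RMax.lift_fst_nonpos (N y k) (ε (y, k))
    rw [← h]
    simp only [ofLex_add, Prod.fst_add, ofLex_sub, Prod.fst_sub] at h1 ⊢
    linarith
  refine ⟨fun k => (x k - x k₀).toRMax, fun y => (c y - x k₀).toRMax, col, ?_, ?_, ?_⟩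
  · simp [ExtReal.toRMax]
  · intro y k
    simp only [heq]
    exact ExtReal.toRMax_mono (sub_le_sub_right (hle y k) _) (hx k)
  · intro k i
    obtain ⟨y, hy, h⟩ := hcol' k i
    exact ⟨y, hy, by simp only [heq, h]⟩

theorem mainTheorem1 (d q : ℕ) (hq : 1 ≤ q) (X : Finset (Fin d → RMax))
    (hX : X.card = (d + 1) * (q - 1) + 1) :
    ∃ P : Fin q → Finset (Fin d → RMax),
      (∀ i j : Fin q, i ≠ j → Disjoint (P i) (P j)) ∧
      (⋃ i : Fin q, (P i : Set (Fin d → RMax))) = (X : Set (Fin d → RMax)) ∧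
      ∃ x : Fin d → RMax, ∀ i : Fin q, x ∈ mpconv (P i) := by
  classical
  obtain ⟨r, rfl⟩ : ∃ r, q = r + 1 := ⟨q - 1, by omega⟩
  -- The label `none` encodes the condition that the coefficients have maximum 0.
  obtain ⟨x, c, col, hx, hle, hcol⟩ := exists_coloring_attaining (X := X) (K := Option (Fin d)) r
    (fun y k => k.elim 0 y.1) none (fun _ => rfl) (by simpa using hX)
  let c' : (Fin d → RMax) → RMax := fun y => if h : y ∈ X then c ⟨y, h⟩ else ⊥
  have hc' : ∀ y : X, c' y = c y := fun y => by simp [c']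
  let P : Fin (r + 1) → Finset (Fin d → RMax) := fun i =>
    (Finset.univ.filter fun y : X => col y = i).image Subtype.val
  have hP : ∀ {i y}, y ∈ P i ↔ ∃ z : X, col z = i ∧ z.1 = y := by simp [P]
  have hsup : ∀ i k, (P i).sup (fun y => c' y + Option.elim k 0 y) = x k := by
    intro i k
    refine le_antisymm (Finset.sup_le fun y hy => ?_) ?_
    · obtain ⟨z, -, rfl⟩ := hP.1 hy
      rw [hc']
      exact hle z k
    · obtain ⟨z, hz, h⟩ := hcol k i
      rw [← h, ← hc']
      exact Finset.le_sup (f := fun y => c' y + Option.elim k 0 y) (hP.2 ⟨z, hz, rfl⟩)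
  refine ⟨P, fun i j hij => ?_, ?_, fun k => x (some k), fun i => ⟨c', ?_, fun k => ?_⟩⟩
  · rw [Finset.disjoint_left]
    rintro y hi hj
    obtain ⟨z, rfl, rfl⟩ := hP.1 hi
    obtain ⟨w, rfl, h⟩ := hP.1 hj
    exact hij (congrArg col (Subtype.ext h.symm))
  · ext y
    simp only [Set.mem_iUnion, Finset.mem_coe, hP]
    exact ⟨fun ⟨_, z, _, h⟩ => h ▸ z.2, fun h => ⟨_, ⟨y, h⟩, rfl, rfl⟩⟩
  · simpa [hx] using hsup i none
  · exact (hsup i (some k)).symm
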